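/- Let $\mathcal A,\mathcal B,\mathcal C$ be extriangulated categories (in the sense of Nakaoka–Palu) with enough projectives and enough injectives which satisfy condition (WIC): if $gf$ is an inflation then so is $f$, and if $gf$ is a deflation then so is $g$. *Conventions.* For an extriangulated category $(\mathscr C,\mathbb E,\mathfrak s)$ as above put $\mathbb E^{n+1}(X,Y)=\mathbb E(\Omega^nX,Y)$ for $n\ge 0$, where $\Omega X$ is a syzygy of $X$, i.e. there is a conflation $\Omega X\to P\to X$ with $P$ projective. Subcategories are full and closed under isomorphisms and direct summands. For a subcategory $\mathscr T$ let ${}^{\perp}\mathscr T=\{X : \mathbb E^n(X,T)=0\ \forall n\ge1,\ T\in\mathscr T\}$, and let $\mathcal X_{\mathscr T}$ be the class of objects $N$ for which there are conflations $K^n\to T^n\to K^{n+1}$ $(n\ge0)$ with $K^0=N$, $T^n\in\mathscr T$ and $K^n\in{}^{\perp}\mathscr T$ for all $n\ge 0$. The subcategory $\mathscr T$ is *Wakamatsu-tilting* if $\mathbb E^n(T,T')=0$ for all $n\ge1$ and $T,T'\in\mathscr T$, and every projective object of $\mathscr C$ lies in $\mathcal X_{\mathscr T}$. A morphism is *compatible*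 if, whenever it is both an inflation and a deflation, it is an isomorphism. A sequence $X\xrightarrow{x}Y\xrightarrow{y}Z$ is *right exact* if $x=h_2h_1$ with $h_1:X\to K$ a compatible deflation and $K\xrightarrow{h_2}Y\xrightarrow{y}Z$ a conflation; *left exact* sequences are defined dually. An additive functor $F$ between extriangulated categories is *right exact* if it preserves compatible morphisms and right exact sequences, and if to every extension $\delta\in\mathbb E(Z,X)$ with $\mathfrak s(\delta)=[X\xrightarrow{x}Y\xrightarrow{y}Z]$ there are assigned an object $X'_\delta$, a compatible deflation $g_\delta:FX\to X'_\delta$ and an extension $\eta(\delta)\in\mathbb E(FZ,X'_\delta)$ with $\mathfrak s(\eta(\delta))=[X'_\delta\xrightarrow{f}FY\xrightarrow{Fy}FZ]$ and $Fx=fg_\delta$, naturally in $\delta$ (for every morphism of extensions $(a,c):\delta\to\delta'$ there is $a':X'_\delta\to X'_{\delta'}$ with $a'g_\delta=g_{\delta'}F(a)$ and $a'_*\eta(\delta)=F(c)^*\eta(\delta')$). *Left exact* functors are defined dually, and $F$ is *exact* if it is both left and right exact. A *recollement* $(\mathcal A,\mathcal B,\mathcal C)$ consists of exact functors $i_*:\mathcal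 A\to\mathcal B$, $j^*:\mathcal B\to\mathcal C$, right exact functors $i^*:\mathcal B\to\mathcal A$, $j_!:\mathcal C\to\mathcal B$ and left exact functors $i^!:\mathcal B\to\mathcal A$, $j_*:\mathcal C\to\mathcal B$ such that $i^*\dashv i_*\dashv i^!$ and $j_!\dashv j^*\dashv j_*$ are adjoint triples; the essential image of $i_*$ is $\operatorname{Ker}j^*$; $i_*,j_!,j_*$ are fully faithful; and for every $X\in\mathcal B$, with $\theta_X,\vartheta_X,\upsilon_X,\nu_X$ the adjunction morphisms, * there are $A\in\mathcal A$ and conflations $i_*i^!X\xrightarrow{\theta_X}X\xrightarrow{y_1}K$ and $K\xrightarrow{y_2}j_*j^*X\to i_*A$ with $y_2$ compatible and $y_2y_1=\vartheta_X$; * there are $A'\in\mathcal A$ and conflations $i_*A'\to j_!j^*X\xrightarrow{z_1}L$ and $L\xrightarrow{z_2}X\xrightarrow{\nu_X}i_*i^*X$ with $z_1$ compatible and $z_2z_1=\upsilon_X$. The recollement is *$\theta$-$\nu$-compatible* if $\theta_X$ and $\nu_X$ are compatible for all $X\in\mathcal B$. **Theorem.** Let $(\mathcal A,\mathcal B,\mathcal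 C)$ be a $\theta$-$\nu$-compatible recollement in which $i^!$ and $i^*$ are exact, and let $\mathcal X'$ and $\mathcal X''$ be Wakamatsu-tilting subcategories of $\mathcal A$ and $\mathcal C$, respectively. Then $$\mathcal X=\{X\in\mathcal B : i^!X\in\mathcal X',\ j^*X\in\mathcal X''\}$$ is a Wakamatsu-tilting subcategory of $\mathcal B$. -/

import Mathlib

open CategoryTheory CategoryTheory.Limits Opposite

universe w v u w₁ v₁ u₁ w₂ v₂ u₂ w₃ v₃ u₃

namespace Extri

section Extensions

variable {C : Type u} [Category.{v} C]

/-- The group `𝔼(Z, X)` of extensions of `Z` by `X`, for a bifunctor `𝔼 : Cᵒᵖ × C ⥤ Ab`. -/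
abbrev Extension (E : Cᵒᵖ ⥤ C ⥤ AddCommGrpCat.{w}) (Z X : C) : Type w :=
  ((E.obj (op Z)).obj X : Type w)

/-- `a_* δ`. -/
def pushforward (E : Cᵒᵖ ⥤ C ⥤ AddCommGrpCat.{w}) {Z X X' : C} (a : X ⟶ X')
    (δ : Extension E Z X) : Extension E Z X' :=
  ((E.obj (op Z)).map a) δ

/-- `c^* δ`. -/
def pullback (E : Cᵒᵖ ⥤ C ⥤ AddCommGrpCat.{w}) {Z' Z X : C} (c : Z' ⟶ Z)
    (δ : Extension E Z X) : Extension E Z' X :=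
  ((E.map c.op).app X) δ

/-- `(a, c)` is a morphism of extensions `δ ⟶ δ'`, i.e. `a_* δ = c^* δ'`. -/
def IsExtensionMorphism (E : Cᵒᵖ ⥤ C ⥤ AddCommGrpCat.{w}) {Z X Z' X' : C}
    (δ : Extension E Z X) (δ' : Extension E Z' X') (a : X ⟶ X') (c : Z ⟶ Z') : Prop :=
  pushforward E a δ = pullback E c δ'

/-- The direct sum `δ ⊕ δ'` in `𝔼(Z ⊕ Z', X ⊕ X')`. -/
noncomputable def extensionSum [Preadditive C] [HasBinaryBiproducts C]
    (E : Cᵒᵖ ⥤ C ⥤ AddCommGrpCat.{w}) {Z X Z' X' : C}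
    (δ : Extension E Z X) (δ' : Extension E Z' X') : Extension E (Z ⊞ Z') (X ⊞ X') :=
  pushforward E biprod.inl (pullback E biprod.fst δ) +
    pushforward E biprod.inr (pullback E biprod.snd δ')

end Extensions

/-- An extriangulated category `(C, 𝔼, 𝔰)` in the sense of Nakaoka and Palu.
The realization `𝔰`, which sends an extension `δ ∈ 𝔼(Z, X)` to an equivalence class of sequences
`X ⟶ Y ⟶ Z`, is encoded by the relation `Realizes δ x y`: "the sequence `(x, y)` lies in the class
`𝔰(δ)`".  The first three axioms about `Realizes` say that, for each `δ`, the sequences `(x, y)`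
with `Realizes δ x y` form exactly one equivalence class. -/
class ExtriangulatedCategory (C : Type u) [Category.{v} C] [Preadditive C] [HasZeroObject C]
    [HasBinaryBiproducts C] where
  /-- The bifunctor `𝔼`. -/
  E : Cᵒᵖ ⥤ C ⥤ AddCommGrpCat.{w}
  /-- (ET1) additivity in the second variable. -/
  pushforward_add : ∀ {Z X X' : C} (a b : X ⟶ X') (δ : Extension E Z X),
    pushforward E (a + b) δ = pushforward E a δ + pushforward E b δ
  /-- (ET1) additivity in the first variable. -/
  pullback_add : ∀ {Z' Z X : C} (a b : Z' ⟶ Z) (δ : Extension E Z X),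
    pullback E (a + b) δ = pullback E a δ + pullback E b δ
  /-- `Realizes δ x y` means `𝔰(δ) = [x, y]`. -/
  Realizes : ∀ {X Y Z : C}, Extension E Z X → (X ⟶ Y) → (Y ⟶ Z) → Prop
  exists_realizes : ∀ {X Z : C} (δ : Extension E Z X),
    ∃ (Y : C) (x : X ⟶ Y) (y : Y ⟶ Z), Realizes δ x y
  realizes_unique : ∀ {X Y Y' Z : C} (δ : Extension E Z X) (x : X ⟶ Y) (y : Y ⟶ Z)
    (x' : X ⟶ Y') (y' : Y' ⟶ Z), Realizes δ x y → Realizes δ x' y' →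
    ∃ b : Y ≅ Y', x ≫ b.hom = x' ∧ b.hom ≫ y' = y
  realizes_of_equiv : ∀ {X Y Y' Z : C} (δ : Extension E Z X) (x : X ⟶ Y) (y : Y ⟶ Z)
    (x' : X ⟶ Y') (y' : Y' ⟶ Z) (b : Y ≅ Y'), Realizes δ x y →
    x ≫ b.hom = x' → b.hom ≫ y' = y → Realizes δ x' y'
  /-- (ET2) `𝔰` is a realization of `𝔼`. -/
  realization : ∀ {X Y Z X' Y' Z' : C} (δ : Extension E Z X) (δ' : Extension E Z' X')
    (x : X ⟶ Y) (y : Y ⟶ Z) (x' : X' ⟶ Y') (y' : Y' ⟶ Z') (a : X ⟶ X') (c : Z ⟶ Z'),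
    Realizes δ x y → Realizes δ' x' y' → IsExtensionMorphism E δ δ' a c →
    ∃ b : Y ⟶ Y', x ≫ b = a ≫ x' ∧ y ≫ c = b ≫ y'
  /-- (ET2) the zero extension is realized by the split sequence. -/
  realizes_zero : ∀ X Z : C,
    Realizes (0 : Extension E Z X) (biprod.inl : X ⟶ X ⊞ Z) (biprod.snd : X ⊞ Z ⟶ Z)
  /-- (ET2) `𝔰` commutes with direct sums. -/
  realizes_sum : ∀ {X Y Z X' Y' Z' : C} (δ : Extension E Z X) (δ' : Extension E Z' X')
    (x : X ⟶ Y) (y : Y ⟶ Z) (x' : X' ⟶ Y') (y' : Y' ⟶ Z'),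
    Realizes δ x y → Realizes δ' x' y' →
    Realizes (extensionSum E δ δ') (biprod.map x x') (biprod.map y y')
  /-- (ET3) -/
  et3 : ∀ {X Y Z X' Y' Z' : C} (δ : Extension E Z X) (δ' : Extension E Z' X')
    (x : X ⟶ Y) (y : Y ⟶ Z) (x' : X' ⟶ Y') (y' : Y' ⟶ Z') (a : X ⟶ X') (b : Y ⟶ Y'),
    Realizes δ x y → Realizes δ' x' y' → x ≫ b = a ≫ x' →
    ∃ c : Z ⟶ Z', IsExtensionMorphism E δ δ' a c ∧ y ≫ c = b ≫ y'
  /-- (ET3)ᵒᵖ -/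
  et3_op : ∀ {X Y Z X' Y' Z' : C} (δ : Extension E Z X) (δ' : Extension E Z' X')
    (x : X ⟶ Y) (y : Y ⟶ Z) (x' : X' ⟶ Y') (y' : Y' ⟶ Z') (b : Y ⟶ Y') (c : Z ⟶ Z'),
    Realizes δ x y → Realizes δ' x' y' → y ≫ c = b ≫ y' →
    ∃ a : X ⟶ X', IsExtensionMorphism E δ δ' a c ∧ x ≫ b = a ≫ x'
  /-- (ET4) -/
  et4 : ∀ {X Y W D F : C} (δ : Extension E D X) (δ' : Extension E F Y)
    (f : X ⟶ Y) (f' : Y ⟶ D) (g : Y ⟶ W) (g' : W ⟶ F),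
    Realizes δ f f' → Realizes δ' g g' →
    ∃ (G : C) (h' : W ⟶ G) (d : D ⟶ G) (e : G ⟶ F) (δ'' : Extension E G X),
      Realizes δ'' (f ≫ g) h' ∧ f' ≫ d = g ≫ h' ∧ h' ≫ e = g' ∧
      Realizes (pushforward E f' δ') d e ∧
      pullback E d δ'' = δ ∧
      pushforward E f δ'' = pullback E e δ'
  /-- (ET4)ᵒᵖ -/
  et4_op : ∀ {X Y W D F : C} (δ : Extension E Y D) (δ' : Extension E W F)
    (f' : D ⟶ X) (f : X ⟶ Y) (g' : F ⟶ Y) (g : Y ⟶ W),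
    Realizes δ f' f → Realizes δ' g' g →
    ∃ (G : C) (h' : G ⟶ X) (d : D ⟶ G) (e : G ⟶ F) (δ'' : Extension E W G),
      Realizes δ'' h' (f ≫ g) ∧ e ≫ g' = h' ≫ f ∧ d ≫ h' = f' ∧
      Realizes (pullback E g' δ) d e ∧
      pushforward E e δ'' = δ' ∧
      pullback E g δ'' = pushforward E d δ

section Basic

variable {C : Type u} [Category.{v} C] [Preadditive C] [HasZeroObject C] [HasBinaryBiproducts C]
  [ExtriangulatedCategory.{w} C]

/-- The extension group `𝔼(Z, X)` of an extriangulated category. -/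
abbrev Ext1 (Z X : C) : Type w := Extension (ExtriangulatedCategory.E (C := C)) Z X

/-- `a_* δ` in an extriangulated category. -/
abbrev push {Z X X' : C} (a : X ⟶ X') (δ : Ext1 Z X) : Ext1 Z X' :=
  pushforward (ExtriangulatedCategory.E (C := C)) a δ

/-- `c^* δ` in an extriangulated category. -/
abbrev pull {Z' Z X : C} (c : Z' ⟶ Z) (δ : Ext1 Z X) : Ext1 Z' X :=
  pullback (ExtriangulatedCategory.E (C := C)) c δ

/-- `X ⟶ Y ⟶ Z ⇢ δ` is an `𝔼`-triangle. -/
def IsETriangle {X Y Z : C} (x : X ⟶ Y) (y : Y ⟶ Z) (δ : Ext1 Z X) : Prop :=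
  ExtriangulatedCategory.Realizes δ x y

def IsConflation {X Y Z : C} (x : X ⟶ Y) (y : Y ⟶ Z) : Prop :=
  ∃ δ : Ext1 Z X, IsETriangle x y δ

def IsInflation {X Y : C} (x : X ⟶ Y) : Prop :=
  ∃ (Z : C) (y : Y ⟶ Z), IsConflation x y

def IsDeflation {Y Z : C} (y : Y ⟶ Z) : Prop :=
  ∃ (X : C) (x : X ⟶ Y), IsConflation x y

/-- A projective object (relative to conflations). -/
def IsProjective (P : C) : Prop :=
  ∀ {X Y Z : C} (x : X ⟶ Y) (y : Y ⟶ Z), IsConflation x y →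
    ∀ f : P ⟶ Z, ∃ g : P ⟶ Y, g ≫ y = f

/-- An injective object (relative to conflations). -/
def IsInjective (I : C) : Prop :=
  ∀ {X Y Z : C} (x : X ⟶ Y) (y : Y ⟶ Z), IsConflation x y →
    ∀ f : X ⟶ I, ∃ g : Y ⟶ I, x ≫ g = f

/-- A morphism is compatible if, when it is both an inflation and a deflation, it is an
isomorphism. -/
def IsCompatible {X Y : C} (f : X ⟶ Y) : Prop :=
  IsInflation f → IsDeflation f → IsIso f

/-- `X ⟶ Y ⟶ Z` is a right exact `𝔼`-triangle. -/
def IsRightExactSeq {X Y Z : C} (x : X ⟶ Y) (y : Y ⟶ Z) : Prop :=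
  ∃ (K : C) (h₁ : X ⟶ K) (h₂ : K ⟶ Y),
    IsConflation h₂ y ∧ IsDeflation h₁ ∧ IsCompatible h₁ ∧ h₁ ≫ h₂ = x

/-- `X ⟶ Y ⟶ Z` is a left exact `𝔼`-triangle. -/
def IsLeftExactSeq {X Y Z : C} (x : X ⟶ Y) (y : Y ⟶ Z) : Prop :=
  ∃ (K : C) (h₁ : Y ⟶ K) (h₂ : K ⟶ Z),
    IsConflation x h₁ ∧ IsInflation h₂ ∧ IsCompatible h₂ ∧ h₁ ≫ h₂ = y

/-- A right exact 4-term `𝔼`-triangle sequence `X ⟶ Y ⟶ Z ⟶ W`. -/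
def IsRightExactFourTerm {X Y Z W : C} (x : X ⟶ Y) (y : Y ⟶ Z) (z : Z ⟶ W) : Prop :=
  ∃ (K : C) (y₁ : Y ⟶ K) (y₂ : K ⟶ Z),
    IsConflation x y₁ ∧ IsConflation y₂ z ∧ y₁ ≫ y₂ = y ∧ IsCompatible y₁

/-- A left exact 4-term `𝔼`-triangle sequence `X ⟶ Y ⟶ Z ⟶ W`. -/
def IsLeftExactFourTerm {X Y Z W : C} (x : X ⟶ Y) (y : Y ⟶ Z) (z : Z ⟶ W) : Prop :=
  ∃ (K : C) (y₁ : Y ⟶ K) (y₂ : K ⟶ Z),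
    IsConflation x y₁ ∧ IsConflation y₂ z ∧ y₁ ≫ y₂ = y ∧ IsCompatible y₂

end Basic

section Conditions

variable (C : Type u) [Category.{v} C] [Preadditive C] [HasZeroObject C] [HasBinaryBiproducts C]
  [ExtriangulatedCategory.{w} C]

class HasEnoughProjectives : Prop where
  exists_deflation : ∀ X : C, ∃ (P : C) (p : P ⟶ X), IsProjective P ∧ IsDeflation p

class HasEnoughInjectives : Prop where
  exists_inflation : ∀ X : C, ∃ (I : C) (i : X ⟶ I), IsInjective I ∧ IsInflation i

/-- Condition (WIC). -/
class IsWIC : Prop where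
  inflation_of_comp : ∀ {X Y Z : C} (f : X ⟶ Y) (g : Y ⟶ Z), IsInflation (f ≫ g) → IsInflation f
  deflation_of_comp : ∀ {X Y Z : C} (f : X ⟶ Y) (g : Y ⟶ Z), IsDeflation (f ≫ g) → IsDeflation g

end Conditions

section HigherExtensions

variable {C : Type u} [Category.{v} C] [Preadditive C] [HasZeroObject C] [HasBinaryBiproducts C]
  [ExtriangulatedCategory.{w} C]

theorem exists_syzygy [HasEnoughProjectives C] (X : C) :
    ∃ (K P : C) (k : K ⟶ P) (p : P ⟶ X), IsProjective P ∧ IsConflation k p := by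
  obtain ⟨P, p, hP, K, k, h⟩ := HasEnoughProjectives.exists_deflation X
  exact ⟨K, P, k, p, hP, h⟩

/-- A chosen syzygy `Ω X`. -/
noncomputable def syzygy [HasEnoughProjectives C] (X : C) : C := (exists_syzygy X).choose

/-- The higher extension group `𝔼ⁿ⁺¹(X, Y) = 𝔼(Ωⁿ X, Y)`; thus `n = 0` gives `𝔼(X, Y)`. -/
abbrev higherExt [HasEnoughProjectives C] (n : ℕ) (X Y : C) : Type w :=
  Ext1 (syzygy^[n] X) Y

/-- `𝔼ⁱ(X, Y) = 0` for all `i ≥ 1`. -/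
def ExtVanish [HasEnoughProjectives C] (X Y : C) : Prop :=
  ∀ n : ℕ, ∀ δ : higherExt n X Y, δ = 0

/-- The left orthogonal `^⊥ T`. -/
def leftPerp [HasEnoughProjectives C] (T : ObjectProperty C) : ObjectProperty C :=
  fun X => ∀ Y : C, T Y → ExtVanish X Y

/-- The subcategory `𝒳_T` of all `N` admitting an infinite `𝔼`-triangle sequence
`N ⟶ T⁰ ⟶ T¹ ⟶ ⋯` with all `Tⁿ` in `T`, obtained by splicing `𝔼`-triangles
`Kⁿ ⟶ Tⁿ ⟶ Kⁿ⁺¹` with `K⁰ = N` and all `Kⁿ` in `^⊥ T`. -/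
def coresolvedBy [HasEnoughProjectives C] (T : ObjectProperty C) : ObjectProperty C :=
  fun N => ∃ (K T' : ℕ → C) (g : ∀ n, K n ⟶ T' n) (f : ∀ n, T' n ⟶ K (n + 1)),
    K 0 = N ∧ (∀ n, IsConflation (g n) (f n)) ∧ (∀ n, leftPerp T (K n)) ∧ ∀ n, T (T' n)

/-- A Wakamatsu-tilting subcategory.  A (full) subcategory is given by its class of objects; it is
closed under isomorphisms and direct summands. -/
structure IsWakamatsuTilting [HasEnoughProjectives C] (T : ObjectProperty C) : Prop where
  closed_iso : ∀ {X Y : C}, (X ≅ Y) → T X → T Y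
  closed_summand : ∀ X Y : C, T (X ⊞ Y) → T X
  /-- (WT1) -/
  self_orthogonal : ∀ X Y : C, T X → T Y → ExtVanish X Y
  /-- (WT2) -/
  projective_coresolved : ∀ P : C, IsProjective P → coresolvedBy T P

end HigherExtensions

section Functors

variable {A : Type u₁} [Category.{v₁} A] [Preadditive A] [HasZeroObject A]
  [HasBinaryBiproducts A] [ExtriangulatedCategory.{w₁} A]
  {B : Type u₂} [Category.{v₂} B] [Preadditive B] [HasZeroObject B]
  [HasBinaryBiproducts B] [ExtriangulatedCategory.{w₂} B]

/-- A right exact functor between extriangulated categories.  In the last condition, each extension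
`δ ∈ 𝔼(Z, X)` with `𝔰(δ) = [x, y]` has an associated `𝔼`-triangle `X' ⟶ F Y ⟶ F Z ⇢ η(δ)` together
with a compatible deflation `F X ⟶ X'` through which `F x` factors.  The object `X'` depends on `δ`,
so naturality of `η` is expressed along the induced morphisms between the objects `X'`. -/
structure IsRightExactFunctor (F : A ⥤ B) : Prop where
  additive : F.Additive
  map_compatible : ∀ {X Y : A} (f : X ⟶ Y), IsCompatible f → IsCompatible (F.map f)
  map_rightExact : ∀ {X Y Z : A} (x : X ⟶ Y) (y : Y ⟶ Z),
    IsRightExactSeq x y → IsRightExactSeq (F.map x) (F.map y)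
  exists_natural : ∃ (X' : ∀ {Z X : A}, Ext1 Z X → B)
    (g : ∀ {Z X : A} (δ : Ext1 Z X), F.obj X ⟶ X' δ)
    (η : ∀ {Z X : A} (δ : Ext1 Z X), Ext1 (F.obj Z) (X' δ)),
    (∀ {Z X : A} (δ : Ext1 Z X), IsDeflation (g δ) ∧ IsCompatible (g δ)) ∧
    (∀ {X Y Z : A} (x : X ⟶ Y) (y : Y ⟶ Z) (δ : Ext1 Z X), IsETriangle x y δ →
      ∃ f : X' δ ⟶ F.obj Y, IsETriangle f (F.map y) (η δ) ∧ g δ ≫ f = F.map x) ∧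
    (∀ {Z₁ X₁ Z₂ X₂ : A} (δ₁ : Ext1 Z₁ X₁) (δ₂ : Ext1 Z₂ X₂) (a : X₁ ⟶ X₂) (c : Z₁ ⟶ Z₂),
      push a δ₁ = pull c δ₂ →
      ∃ a' : X' δ₁ ⟶ X' δ₂, g δ₁ ≫ a' = F.map a ≫ g δ₂ ∧
        push a' (η δ₁) = pull (F.map c) (η δ₂))

/-- A left exact functor between extriangulated categories (the dual notion): each extension
`δ ∈ 𝔼(Z, X)` with `𝔰(δ) = [x, y]` has an associated `𝔼`-triangle `F X ⟶ F Y ⟶ Z' ⇢ η(δ)` together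
with a compatible inflation `Z' ⟶ F Z` through which `F y` factors. -/
structure IsLeftExactFunctor (F : A ⥤ B) : Prop where
  additive : F.Additive
  map_compatible : ∀ {X Y : A} (f : X ⟶ Y), IsCompatible f → IsCompatible (F.map f)
  map_leftExact : ∀ {X Y Z : A} (x : X ⟶ Y) (y : Y ⟶ Z),
    IsLeftExactSeq x y → IsLeftExactSeq (F.map x) (F.map y)
  exists_natural : ∃ (Z' : ∀ {Z X : A}, Ext1 Z X → B)
    (h : ∀ {Z X : A} (δ : Ext1 Z X), Z' δ ⟶ F.obj Z)
    (η : ∀ {Z X : A} (δ : Ext1 Z X), Ext1 (Z' δ) (F.obj X)),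
    (∀ {Z X : A} (δ : Ext1 Z X), IsInflation (h δ) ∧ IsCompatible (h δ)) ∧
    (∀ {X Y Z : A} (x : X ⟶ Y) (y : Y ⟶ Z) (δ : Ext1 Z X), IsETriangle x y δ →
      ∃ f : F.obj Y ⟶ Z' δ, IsETriangle (F.map x) f (η δ) ∧ f ≫ h δ = F.map y) ∧
    (∀ {Z₁ X₁ Z₂ X₂ : A} (δ₁ : Ext1 Z₁ X₁) (δ₂ : Ext1 Z₂ X₂) (a : X₁ ⟶ X₂) (c : Z₁ ⟶ Z₂),
      push a δ₁ = pull c δ₂ →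
      ∃ c' : Z' δ₁ ⟶ Z' δ₂, c' ≫ h δ₂ = h δ₁ ≫ F.map c ∧
        push (F.map a) (η δ₁) = pull c' (η δ₂))

/-- An exact functor is one that is both right exact and left exact. -/
structure IsExactFunctor (F : A ⥤ B) : Prop where
  rightExact : IsRightExactFunctor F
  leftExact : IsLeftExactFunctor F

end Functors

section Recollements

variable (A : Type u₁) [Category.{v₁} A] [Preadditive A] [HasZeroObject A]
  [HasBinaryBiproducts A] [ExtriangulatedCategory.{w₁} A]
  (B : Type u₂) [Category.{v₂} B] [Preadditive B] [HasZeroObject B]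
  [HasBinaryBiproducts B] [ExtriangulatedCategory.{w₂} B]
  (C : Type u₃) [Category.{v₃} C] [Preadditive C] [HasZeroObject C]
  [HasBinaryBiproducts C] [ExtriangulatedCategory.{w₃} C]

/-- A recollement `(A, B, C)` of extriangulated categories. -/
structure Recollement where
  /-- `i^*` -/
  iUpperStar : B ⥤ A
  /-- `i_*` -/
  iLowerStar : A ⥤ B
  /-- `i^!` -/
  iUpperShriek : B ⥤ A
  /-- `j_!` -/
  jLowerShriek : C ⥤ B
  /-- `j^*` -/
  jUpperStar : B ⥤ C
  /-- `j_*` -/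
  jLowerStar : C ⥤ B
  iLowerStar_exact : IsExactFunctor iLowerStar
  jUpperStar_exact : IsExactFunctor jUpperStar
  iUpperStar_rightExact : IsRightExactFunctor iUpperStar
  jLowerShriek_rightExact : IsRightExactFunctor jLowerShriek
  iUpperShriek_leftExact : IsLeftExactFunctor iUpperShriek
  jLowerStar_leftExact : IsLeftExactFunctor jLowerStar
  /-- `i^* ⊣ i_*` -/
  adjI₁ : iUpperStar ⊣ iLowerStar
  /-- `i_* ⊣ i^!` -/
  adjI₂ : iLowerStar ⊣ iUpperShriek
  /-- `j_! ⊣ j^*` -/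
  adjJ₁ : jLowerShriek ⊣ jUpperStar
  /-- `j^* ⊣ j_*` -/
  adjJ₂ : jUpperStar ⊣ jLowerStar
  /-- `Im i_* = Ker j^*` -/
  essImage_eq_ker : ∀ Y : B, iLowerStar.essImage Y ↔ IsZero (jUpperStar.obj Y)
  iLowerStar_full : iLowerStar.Full
  iLowerStar_faithful : iLowerStar.Faithful
  jLowerShriek_full : jLowerShriek.Full
  jLowerShriek_faithful : jLowerShriek.Faithful
  jLowerStar_full : jLowerStar.Full
  jLowerStar_faithful : jLowerStar.Faithful
  /-- The left exact sequence `i_* i^! X ⟶ X ⟶ j_* j^* X ⟶ i_* A'`. -/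
  left_sequence : ∀ X : B, ∃ (A' : A) (z : jLowerStar.obj (jUpperStar.obj X) ⟶ iLowerStar.obj A'),
    IsLeftExactFourTerm (adjI₂.counit.app X : iLowerStar.obj (iUpperShriek.obj X) ⟶ X)
      (adjJ₂.unit.app X : X ⟶ jLowerStar.obj (jUpperStar.obj X)) z
  /-- The right exact sequence `i_* A' ⟶ j_! j^* X ⟶ X ⟶ i_* i^* X`. -/
  right_sequence : ∀ X : B,
    ∃ (A' : A) (x : iLowerStar.obj A' ⟶ jLowerShriek.obj (jUpperStar.obj X)),
    IsRightExactFourTerm x (adjJ₁.counit.app X : jLowerShriek.obj (jUpperStar.obj X) ⟶ X)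
      (adjI₁.unit.app X : X ⟶ iLowerStar.obj (iUpperStar.obj X))

variable {A B C}

/-- The recollement is `θ`-`ν`-compatible: the adjunction morphisms `θ_X : i_* i^! X ⟶ X` and
`ν_X : X ⟶ i_* i^* X` are compatible for all `X`. -/
def Recollement.IsThetaNuCompatible (R : Recollement A B C) : Prop :=
  ∀ X : B,
    IsCompatible (R.adjI₂.counit.app X : R.iLowerStar.obj (R.iUpperShriek.obj X) ⟶ X) ∧
    IsCompatible (R.adjI₁.unit.app X : X ⟶ R.iLowerStar.obj (R.iUpperStar.obj X))

/-- The glued subcategory `{X ∈ B : i^! X ∈ X', j^* X ∈ X''}`. -/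
def Recollement.glue (R : Recollement A B C) (X' : ObjectProperty A) (X'' : ObjectProperty C) :
    ObjectProperty B :=
  fun X => X' (R.iUpperShriek.obj X) ∧ X'' (R.jUpperStar.obj X)

end Recollements

end Extri

/-!
Exactness of `i^!` and `i^*` turns the four-term sequences of the recollement into conflations
`i_* i^! X ⟶ X ⟶ j_* j^* X` and `j_! j^* X ⟶ X ⟶ i_* i^* X`.  Compatibility of the morphisms
`θ_X : i_* i^! X ⟶ X` forces `i^! j_! = 0`, so that `j_* j^* X ≅ j_! j^* X` splits the first
conflation: `X ≅ i_* i^! X ⊕ j_* j^* X` and `i^* ≅ i^!`.  The adjunctions `i^* ⊣ i_*` and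
`j^* ⊣ j_*` then reduce the vanishing of `𝔼ⁿ(X, Y)` to that of `𝔼ⁿ(i^! X, i^! Y)` and
`𝔼ⁿ(j^* X, j^* Y)`, and coresolutions in `A` and `C` add up to coresolutions in `B`.
-/

namespace Extri

open scoped ZeroObject

section ETriangles

variable {C : Type u} [Category.{v} C] [Preadditive C] [HasZeroObject C] [HasBinaryBiproducts C]
  [ExtriangulatedCategory.{w} C]

@[simp]
theorem push_id {Z X : C} (δ : Ext1 Z X) : push (𝟙 X) δ = δ := by
  simp [push, pushforward]

@[simp]
theorem pull_id {Z X : C} (δ : Ext1 Z X) : pull (𝟙 Z) δ = δ := by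
  simp [pull, pullback]

theorem push_comp {Z X X' X'' : C} (a : X ⟶ X') (b : X' ⟶ X'') (δ : Ext1 Z X) :
    push (a ≫ b) δ = push b (push a δ) := by
  simp [push, pushforward]

theorem pull_comp {Z'' Z' Z X : C} (c : Z'' ⟶ Z') (d : Z' ⟶ Z) (δ : Ext1 Z X) :
    pull (c ≫ d) δ = pull c (pull d δ) := by
  simp [pull, pullback]

theorem push_pull {Z' Z X X' : C} (a : X ⟶ X') (c : Z' ⟶ Z) (δ : Ext1 Z X) :
    push a (pull c δ) = pull c (push a δ) :=
  (ConcreteCategory.congr_hom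
    (((ExtriangulatedCategory.E (C := C)).map c.op).naturality a) δ).symm

theorem push_add {Z X X' : C} (a : X ⟶ X') (δ ε : Ext1 Z X) :
    push a (δ + ε) = push a δ + push a ε :=
  map_add (((ExtriangulatedCategory.E (C := C)).obj (op Z)).map a).hom δ ε

@[simp]
theorem push_zero {Z X X' : C} (a : X ⟶ X') : push a (0 : Ext1 Z X) = 0 :=
  map_zero (((ExtriangulatedCategory.E (C := C)).obj (op Z)).map a).hom

@[simp]
theorem pull_zero {Z' Z X : C} (c : Z' ⟶ Z) : pull c (0 : Ext1 Z X) = 0 :=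
  map_zero (((ExtriangulatedCategory.E (C := C)).map c.op).app X).hom

theorem add_push {Z X X' : C} (a b : X ⟶ X') (δ : Ext1 Z X) :
    push (a + b) δ = push a δ + push b δ :=
  ExtriangulatedCategory.pushforward_add a b δ

theorem add_pull {Z' Z X : C} (a b : Z' ⟶ Z) (δ : Ext1 Z X) :
    pull (a + b) δ = pull a δ + pull b δ :=
  ExtriangulatedCategory.pullback_add a b δ

@[simp]
theorem zero_push {Z X X' : C} (δ : Ext1 Z X) : push (0 : X ⟶ X') δ = 0 := by
  simpa using add_push (0 : X ⟶ X') 0 δ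

@[simp]
theorem zero_pull {Z' Z X : C} (δ : Ext1 Z X) : pull (0 : Z' ⟶ Z) δ = 0 := by
  simpa using add_pull (0 : Z' ⟶ Z) 0 δ

theorem subsingleton_ext1_of_retract_left {Z Z' X : C} (r : Retract Z Z')
    [Subsingleton (Ext1 Z' X)] : Subsingleton (Ext1 Z X) :=
  subsingleton_of_forall_eq 0 fun δ => by
    rw [← pull_id δ, ← r.retract, pull_comp, Subsingleton.elim (pull r.r δ) 0, pull_zero]

theorem subsingleton_ext1_of_retract_right {Z X X' : C} (r : Retract X X')
    [Subsingleton (Ext1 Z X')] : Subsingleton (Ext1 Z X) :=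
  subsingleton_of_forall_eq 0 fun δ => by
    rw [← push_id δ, ← r.retract, push_comp, Subsingleton.elim (push r.i δ) 0, push_zero]

theorem subsingleton_ext1_biprod_left {Z Z' X : C} [Subsingleton (Ext1 Z X)]
    [Subsingleton (Ext1 Z' X)] : Subsingleton (Ext1 (Z ⊞ Z') X) :=
  subsingleton_of_forall_eq 0 fun δ => by
    rw [← pull_id δ, ← biprod.total, add_pull, pull_comp, pull_comp,
      Subsingleton.elim (pull biprod.inl δ) 0, Subsingleton.elim (pull biprod.inr δ) 0,
      pull_zero, pull_zero, add_zero]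

theorem subsingleton_ext1_biprod_right {Z X X' : C} [Subsingleton (Ext1 Z X)]
    [Subsingleton (Ext1 Z X')] : Subsingleton (Ext1 Z (X ⊞ X')) :=
  subsingleton_of_forall_eq 0 fun δ => by
    rw [← push_id δ, ← biprod.total, add_push, push_comp, push_comp,
      Subsingleton.elim (push biprod.fst δ) 0, Subsingleton.elim (push biprod.snd δ) 0,
      push_zero, push_zero, add_zero]

theorem isETriangle_inl_snd (X Z : C) :
    IsETriangle (biprod.inl : X ⟶ X ⊞ Z) (biprod.snd : X ⊞ Z ⟶ Z) 0 :=
  ExtriangulatedCategory.realizes_zero X Z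

theorem isETriangle_id_zero (X : C) {Z : C} (hZ : IsZero Z) (y : X ⟶ Z) :
    IsETriangle (𝟙 X) y (0 : Ext1 Z X) :=
  ExtriangulatedCategory.realizes_of_equiv _ _ _ _ _ (isoBiprodZero hZ).symm
    (isETriangle_inl_snd X Z) (by simp) (hZ.eq_of_tgt _ _)

theorem isETriangle_zero_id {X : C} (hX : IsZero X) (Z : C) (x : X ⟶ Z) :
    IsETriangle x (𝟙 Z) (0 : Ext1 Z X) :=
  ExtriangulatedCategory.realizes_of_equiv _ _ _ _ _ (isoZeroBiprod hX).symm
    (isETriangle_inl_snd X Z) (hX.eq_of_src _ _) (by simp)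

namespace IsETriangle

section

variable {X Y Z : C} {x : X ⟶ Y} {y : Y ⟶ Z} {δ : Ext1 Z X} (h : IsETriangle x y δ)
include h

theorem comp_eq_zero : x ≫ y = 0 := by
  obtain ⟨c, -, hc⟩ := ExtriangulatedCategory.et3 (0 : Ext1 (0 : C) X) δ (𝟙 X) 0 x y (𝟙 X) x
    (isETriangle_id_zero X (isZero_zero C) _) h rfl
  simpa using hc.symm

theorem push_self : push x δ = 0 := by
  obtain ⟨c, hc, -⟩ := ExtriangulatedCategory.et3 δ (0 : Ext1 (0 : C) Y) x y (𝟙 Y) 0 x (𝟙 Y) h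
    (isETriangle_id_zero Y (isZero_zero C) _) rfl
  exact hc.trans (pull_zero c)

theorem pull_self : pull y δ = 0 := by
  obtain ⟨a, ha, -⟩ := ExtriangulatedCategory.et3_op (0 : Ext1 Y (0 : C)) δ 0 (𝟙 Y) x y (𝟙 Y) y
    (isETriangle_zero_id (isZero_zero C) Y _) h rfl
  exact ha.symm.trans (push_zero a)

theorem exists_lift {T : C} (f : T ⟶ Y) (hf : f ≫ y = 0) : ∃ a : T ⟶ X, a ≫ x = f := by
  obtain ⟨a, -, ha⟩ := ExtriangulatedCategory.et3_op (0 : Ext1 (0 : C) T) δ (𝟙 T) 0 x y f 0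
    (isETriangle_id_zero T (isZero_zero C) _) h (by simp [hf])
  exact ⟨a, by simpa using ha.symm⟩

theorem exists_desc {T : C} (f : Y ⟶ T) (hf : x ≫ f = 0) : ∃ c : Z ⟶ T, y ≫ c = f := by
  obtain ⟨c, -, hc⟩ := ExtriangulatedCategory.et3 δ (0 : Ext1 T (0 : C)) x y 0 (𝟙 T) 0 f
    h (isETriangle_zero_id (isZero_zero C) T _) (by simp [hf])
  exact ⟨c, by simpa using hc⟩

theorem exists_lift_of_pull_eq_zero {T : C} (f : T ⟶ Z) (hf : pull f δ = 0) :
    ∃ g : T ⟶ Y, g ≫ y = f := by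
  obtain ⟨b, -, hb⟩ := ExtriangulatedCategory.realization (0 : Ext1 T X) δ _ _ x y (𝟙 X) f
    (isETriangle_inl_snd X T) h ((push_zero _).trans hf.symm)
  exact ⟨biprod.inr ≫ b, by simp [← hb]⟩

theorem exists_desc_of_push_eq_zero {T : C} (f : X ⟶ T) (hf : push f δ = 0) :
    ∃ g : Y ⟶ T, x ≫ g = f := by
  obtain ⟨b, hb, -⟩ := ExtriangulatedCategory.realization δ (0 : Ext1 Z T) x y _ _ f (𝟙 Z)
    h (isETriangle_inl_snd T Z) (hf.trans (pull_zero _).symm)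
  exact ⟨b ≫ biprod.fst, by simp [reassoc_of% hb]⟩

theorem eq_zero_of_retraction (r : Y ⟶ X) (hr : x ≫ r = 𝟙 X) : δ = 0 := by
  rw [← push_id δ, ← hr, push_comp, h.push_self, push_zero]

theorem eq_zero_of_section (s : Z ⟶ Y) (hs : s ≫ y = 𝟙 Z) : δ = 0 := by
  rw [← pull_id δ, ← hs, pull_comp, h.pull_self, pull_zero]

theorem nonempty_iso_biprod (hδ : δ = 0) : Nonempty (Y ≅ X ⊞ Z) := by
  subst hδ
  obtain ⟨b, -⟩ :=
    ExtriangulatedCategory.realizes_unique _ _ _ _ _ h (isETriangle_inl_snd X Z)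
  exact ⟨b⟩

end

theorem isIso_middle {X Y Z X' Y' Z' : C} {x : X ⟶ Y} {y : Y ⟶ Z} {δ : Ext1 Z X}
    {x' : X' ⟶ Y'} {y' : Y' ⟶ Z'} {δ' : Ext1 Z' X'} (h : IsETriangle x y δ)
    (h' : IsETriangle x' y' δ') (a : X ≅ X') (b : Y ⟶ Y') (c : Z ≅ Z')
    (hx : x ≫ b = a.hom ≫ x') (hy : y ≫ c.hom = b ≫ y')
    (hac : push a.hom δ = pull c.hom δ') : IsIso b := by
  have hac' : push a.inv δ' = pull c.inv δ := by
    rw [← push_id (pull c.inv δ), ← a.hom_inv_id, push_comp, push_pull, hac, ← pull_comp,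
      c.inv_hom_id, pull_id]
  obtain ⟨t, ht⟩ := h.exists_lift_of_pull_eq_zero (y' ≫ c.inv)
    (by rw [pull_comp, ← hac', ← push_pull, h'.pull_self, push_zero])
  obtain ⟨t', ht'⟩ := h'.exists_desc_of_push_eq_zero (a.inv ≫ x)
    (by rw [push_comp, hac', push_pull, h.push_self, pull_zero])
  obtain ⟨u, hu⟩ := h'.exists_lift (𝟙 Y' - t ≫ b) (by simp [← hy, reassoc_of% ht])
  obtain ⟨v, hv⟩ := h.exists_desc (𝟙 Y - b ≫ t') (by simp [reassoc_of% hx, ht'])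
  have : IsSplitEpi b := ⟨⟨⟨t + u ≫ a.inv ≫ x, by simp [hx, hu]⟩⟩⟩
  have : IsSplitMono b := ⟨⟨⟨t' + y' ≫ c.inv ≫ v, by simp [← reassoc_of% hy, hv]⟩⟩⟩
  exact isIso_of_mono_of_isSplitEpi b

end IsETriangle

end ETriangles

section Conflations

variable {C : Type u} [Category.{v} C] [Preadditive C] [HasZeroObject C] [HasBinaryBiproducts C]
  [ExtriangulatedCategory.{w} C]

namespace IsConflation

section

variable {X Y Z : C} {x : X ⟶ Y} {y : Y ⟶ Z}

theorem of_iso {X' Y' Z' : C} {x' : X' ⟶ Y'} {y' : Y' ⟶ Z'} (h : IsConflation x y)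
    (a : X ≅ X') (b : Y ≅ Y') (c : Z ≅ Z') (hx : x ≫ b.hom = a.hom ≫ x')
    (hy : y ≫ c.hom = b.hom ≫ y') : IsConflation x' y' := by
  obtain ⟨δ, hδ⟩ := h
  obtain ⟨N, t, n, ht⟩ := ExtriangulatedCategory.exists_realizes (push a.hom (pull c.inv δ))
  have hac : push a.hom δ = pull c.hom (push a.hom (pull c.inv δ)) := by
    rw [← push_pull, ← pull_comp, c.hom_inv_id, pull_id]
  obtain ⟨m, hm, hm'⟩ := ExtriangulatedCategory.realization _ _ _ _ _ _ _ _ hδ ht hac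
  have : IsIso m := hδ.isIso_middle ht a m c hm hm' hac
  refine ⟨_, ExtriangulatedCategory.realizes_of_equiv _ _ _ _ _ ((asIso m).symm ≪≫ b) ht ?_ ?_⟩
  · rw [← cancel_epi a.hom, ← hx, ← reassoc_of% hm]
    simp
  · rw [← cancel_epi m, ← hm', hy]
    simp

theorem iso_comp {X' : C} (h : IsConflation x y) (a : X' ≅ X) : IsConflation (a.hom ≫ x) y :=
  h.of_iso a.symm (Iso.refl Y) (Iso.refl Z) (by simp) (by simp)

theorem comp_iso {Z' : C} (h : IsConflation x y) (c : Z ≅ Z') : IsConflation x (y ≫ c.hom) :=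
  h.of_iso (Iso.refl X) (Iso.refl Y) c (by simp) (by simp)

theorem isIso_left (h : IsConflation x y) (hZ : IsZero Z) : IsIso x := by
  obtain ⟨δ, hδ⟩ := h
  have : δ = 0 := by rw [← pull_id δ, hZ.eq_of_src (𝟙 Z) 0, zero_pull]
  exact (isETriangle_id_zero X hZ 0).isIso_middle hδ (Iso.refl X) x (Iso.refl Z) (by simp)
    (hZ.eq_of_tgt _ _) (by simp [this])

theorem isIso_right (h : IsConflation x y) (hX : IsZero X) : IsIso y := by
  obtain ⟨δ, hδ⟩ := h
  have : δ = 0 := by rw [← push_id δ, hX.eq_of_src (𝟙 X) 0, zero_push]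
  exact hδ.isIso_middle (isETriangle_zero_id hX Z 0) (Iso.refl X) y (Iso.refl Z)
    (hX.eq_of_src _ _) (by simp) (by simp [this])

theorem isZero_right_of_isIso (h : IsConflation x y) [IsIso x] : IsZero Z := by
  obtain ⟨δ, hδ⟩ := h
  have hδ₀ : δ = 0 := hδ.eq_zero_of_retraction (inv x) (by simp)
  obtain ⟨s, hs⟩ := hδ.exists_lift_of_pull_eq_zero (𝟙 Z) (by simp [hδ₀])
  have hy : y = 0 := by rw [← cancel_epi x, hδ.comp_eq_zero, comp_zero]
  rw [IsZero.iff_id_eq_zero, ← hs, hy, comp_zero]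

theorem isZero_left_of_isIso (h : IsConflation x y) [IsIso y] : IsZero X := by
  obtain ⟨δ, hδ⟩ := h
  have hδ₀ : δ = 0 := hδ.eq_zero_of_section (inv y) (by simp)
  obtain ⟨r, hr⟩ := hδ.exists_desc_of_push_eq_zero (𝟙 X) (by simp [hδ₀])
  have hx : x = 0 := by rw [← cancel_mono y, hδ.comp_eq_zero, zero_comp]
  rw [IsZero.iff_id_eq_zero, ← hr, hx, zero_comp]

theorem isZero_right (h : IsConflation x y) (hX : IsZero X) (hY : IsZero Y) : IsZero Z :=
  have := h.isIso_right hX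
  hY.of_iso (asIso y).symm

theorem isZero_left (h : IsConflation x y) (hY : IsZero Y) (hZ : IsZero Z) : IsZero X :=
  have := h.isIso_left hZ
  hY.of_iso (asIso x)

theorem biprod {X' Y' Z' : C} {x' : X' ⟶ Y'} {y' : Y' ⟶ Z'} (h : IsConflation x y)
    (h' : IsConflation x' y') : IsConflation (biprod.map x x') (biprod.map y y') :=
  let ⟨_, hδ⟩ := h
  let ⟨_, hδ'⟩ := h'
  ⟨_, ExtriangulatedCategory.realizes_sum _ _ _ _ _ _ hδ hδ'⟩

theorem biprod_id (h : IsConflation x y) (W : C) :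
    IsConflation (x ≫ biprod.inl) (biprod.map y (𝟙 W)) :=
  (h.biprod ⟨0, isETriangle_zero_id (isZero_zero C) W 0⟩).of_iso
    (isoBiprodZero (isZero_zero C)).symm (Iso.refl _) (Iso.refl _)
    (by ext <;> simp) (by simp)

end

end IsConflation

theorem IsETriangle.exists_conflation_comp {X Y D W F G : C} {f : X ⟶ Y} {f' : Y ⟶ D}
    {g : Y ⟶ W} {g' : W ⟶ F} {δ' : Ext1 F Y} {d : D ⟶ G} {e : G ⟶ F}
    (hg : IsETriangle g g' δ') (hd : IsETriangle d e (push f' δ')) (hf : IsConflation f f') :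
    ∃ k : W ⟶ G, IsConflation (f ≫ g) k ∧ g ≫ k = f' ≫ d := by
  obtain ⟨δ, hδ⟩ := hf
  obtain ⟨G', k, d', e', δ'', hk, hd', -, hG', -, -⟩ := ExtriangulatedCategory.et4 _ _ _ _ _ _ hδ hg
  obtain ⟨b, hb, -⟩ := ExtriangulatedCategory.realizes_unique _ _ _ _ _ hG' hd
  exact ⟨k ≫ b.hom, IsConflation.comp_iso ⟨δ'', hk⟩ b, by rw [← reassoc_of% hd', hb]⟩

theorem IsConflation.exists_homotopy_pullback {X₁ Y₁ X₂ Y₂ Z : C} {x₁ : X₁ ⟶ Y₁} {y₁ : Y₁ ⟶ Z}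
    {x₂ : X₂ ⟶ Y₂} {y₂ : Y₂ ⟶ Z} (h₁ : IsConflation x₁ y₁) (h₂ : IsConflation x₂ y₂) :
    ∃ (M : C) (m₁ : X₁ ⟶ M) (e₁ : M ⟶ Y₂) (m₂ : X₂ ⟶ M) (e₂ : M ⟶ Y₁),
      IsConflation m₁ e₁ ∧ IsConflation m₂ e₂ ∧ m₁ ≫ e₂ = x₁ ∧ m₂ ≫ e₁ = x₂ := by
  obtain ⟨δ₁, hδ₁⟩ := h₁
  obtain ⟨δ₂, hδ₂⟩ := h₂
  obtain ⟨μ, rfl, rfl⟩ : ∃ μ : Ext1 Z (X₁ ⊞ X₂), push biprod.fst μ = δ₁ ∧ push biprod.snd μ = δ₂ :=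
    ⟨push biprod.inl δ₁ + push biprod.inr δ₂, by simp [push_add, ← push_comp],
      by simp [push_add, ← push_comp]⟩
  obtain ⟨M, m, n, hM⟩ := ExtriangulatedCategory.exists_realizes μ
  have hinl : IsConflation (biprod.inl : X₁ ⟶ X₁ ⊞ X₂) biprod.snd := ⟨0, isETriangle_inl_snd _ _⟩
  have hinr : IsConflation (biprod.inr : X₂ ⟶ X₁ ⊞ X₂) biprod.fst :=
    IsConflation.of_iso ⟨0, isETriangle_inl_snd X₂ X₁⟩ (Iso.refl _) (biprod.braiding X₂ X₁)
      (Iso.refl _) (by ext <;> simp) (by simp)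
  obtain ⟨e₁, he₁, hme₁⟩ := IsETriangle.exists_conflation_comp hM hδ₂ hinl
  obtain ⟨e₂, he₂, hme₂⟩ := IsETriangle.exists_conflation_comp hM hδ₁ hinr
  exact ⟨M, biprod.inl ≫ m, e₁, biprod.inr ≫ m, e₂, he₁, he₂, by simp [hme₂], by simp [hme₁]⟩

theorem IsInflation.of_iso {X Y X' Y' : C} {f : X ⟶ Y} {f' : X' ⟶ Y'} (h : IsInflation f)
    (a : X ≅ X') (b : Y ≅ Y') (hf : f ≫ b.hom = a.hom ≫ f') : IsInflation f' :=
  let ⟨_, y, h⟩ := h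
  ⟨_, b.inv ≫ y, h.of_iso a b (Iso.refl _) hf (by simp)⟩

theorem IsDeflation.of_iso {X Y X' Y' : C} {f : X ⟶ Y} {f' : X' ⟶ Y'} (h : IsDeflation f)
    (a : X ≅ X') (b : Y ≅ Y') (hf : f ≫ b.hom = a.hom ≫ f') : IsDeflation f' :=
  let ⟨_, x, h⟩ := h
  ⟨_, x ≫ a.hom, h.of_iso (Iso.refl _) a b (by simp) hf⟩

theorem isDeflation_of_isZero {X Z : C} (hZ : IsZero Z) (f : X ⟶ Z) : IsDeflation f :=
  ⟨X, 𝟙 X, 0, isETriangle_id_zero X hZ f⟩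

theorem IsConflation.isDeflation_of_isZero {X Y Z K W : C} {x : X ⟶ Y} {y : Y ⟶ Z} {k : K ⟶ W}
    {p : W ⟶ Z} (h : IsConflation x y) (h' : IsConflation k p) (hW : IsZero W) :
    IsDeflation x := by
  obtain ⟨M, m₁, e₁, m₂, e₂, h₁, h₂, hx, -⟩ := h.exists_homotopy_pullback h'
  have := h₁.isIso_left hW
  exact IsDeflation.of_iso ⟨_, _, h₂⟩ (asIso m₁).symm (Iso.refl Y) (by simp [← hx])

end Conflations

section Projectives

variable {C : Type u} [Category.{v} C] [Preadditive C] [HasZeroObject C] [HasBinaryBiproducts C]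
  [ExtriangulatedCategory.{w} C]

theorem IsProjective.subsingleton_ext1 {P : C} (hP : IsProjective P) (X : C) :
    Subsingleton (Ext1 P X) :=
  subsingleton_of_forall_eq 0 fun δ => by
    obtain ⟨Y, x, y, h⟩ := ExtriangulatedCategory.exists_realizes δ
    obtain ⟨s, hs⟩ := hP x y ⟨δ, h⟩ (𝟙 P)
    exact IsETriangle.eq_zero_of_section h s hs

theorem IsProjective.of_iso {P Q : C} (hP : IsProjective P) (e : P ≅ Q) : IsProjective Q := by
  intro X Y Z x y h f
  obtain ⟨g, hg⟩ := hP x y h (e.hom ≫ f)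
  exact ⟨e.inv ≫ g, by simp [hg]⟩

theorem IsProjective.biprod {P Q : C} (hP : IsProjective P) (hQ : IsProjective Q) :
    IsProjective (P ⊞ Q) := by
  intro X Y Z x y h f
  obtain ⟨g, hg⟩ := hP x y h (biprod.inl ≫ f)
  obtain ⟨g', hg'⟩ := hQ x y h (biprod.inr ≫ f)
  exact ⟨biprod.desc g g', by ext <;> simp [hg, hg']⟩

theorem IsConflation.nonempty_iso_biprod_of_isProjective {X Y P : C} {x : X ⟶ Y} {y : Y ⟶ P}
    (h : IsConflation x y) (hP : IsProjective P) : Nonempty (Y ≅ X ⊞ P) :=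
  have := hP.subsingleton_ext1 X
  let ⟨δ, hδ⟩ := h
  hδ.nonempty_iso_biprod (Subsingleton.elim δ 0)

/-- Two objects are stably isomorphic if they become isomorphic after adding projective summands.
Syzygies are only defined up to this relation, and higher extension groups vanish compatibly
with it. -/
def IsStablyIso (X X' : C) : Prop :=
  ∃ P P' : C, IsProjective P ∧ IsProjective P' ∧ Nonempty (X ⊞ P ≅ X' ⊞ P')

/-- Schanuel's lemma. -/
theorem IsConflation.isStablyIso {K P K' P' X : C} {k : K ⟶ P} {p : P ⟶ X} {k' : K' ⟶ P'}
    {p' : P' ⟶ X} (h : IsConflation k p) (h' : IsConflation k' p') (hP : IsProjective P)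
    (hP' : IsProjective P') : IsStablyIso K K' := by
  obtain ⟨M, m, e, m', e', hM, hM', -, -⟩ := h.exists_homotopy_pullback h'
  obtain ⟨b⟩ := hM.nonempty_iso_biprod_of_isProjective hP'
  obtain ⟨b'⟩ := hM'.nonempty_iso_biprod_of_isProjective hP
  exact ⟨P', P, hP', hP, ⟨b.symm ≪≫ b'⟩⟩

theorem IsStablyIso.subsingleton_ext1 {X X' Y : C} (h : IsStablyIso X X')
    (hX : Subsingleton (Ext1 X Y)) : Subsingleton (Ext1 X' Y) := by
  obtain ⟨P, P', hP, -, ⟨e⟩⟩ := h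
  have := hP.subsingleton_ext1 Y
  have := subsingleton_ext1_biprod_left (Z := X) (Z' := P) (X := Y)
  exact subsingleton_ext1_of_retract_left
    (Retract.trans ⟨biprod.inl, biprod.fst, biprod.inl_fst⟩ (Retract.ofIso e.symm))

variable [HasEnoughProjectives C]

theorem exists_conflation_syzygy (X : C) :
    ∃ (P : C) (k : syzygy X ⟶ P) (p : P ⟶ X), IsProjective P ∧ IsConflation k p :=
  (exists_syzygy X).choose_spec

theorem IsStablyIso.of_iso {X X' : C} (e : X ≅ X') : IsStablyIso X X' :=
  let ⟨P, _, _, hP, _⟩ := exists_conflation_syzygy X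
  ⟨P, P, hP, hP, ⟨biprod.mapIso e (Iso.refl P)⟩⟩

theorem IsConflation.isStablyIso_syzygy {K P X : C} {k : K ⟶ P} {p : P ⟶ X}
    (h : IsConflation k p) (hP : IsProjective P) : IsStablyIso (syzygy X) K :=
  let ⟨_, _, _, hQ, h'⟩ := exists_conflation_syzygy X
  h'.isStablyIso h hQ hP

theorem IsStablyIso.syzygy {X X' : C} (h : IsStablyIso X X') :
    IsStablyIso (syzygy X) (Extri.syzygy X') := by
  obtain ⟨P, P', hP, hP', ⟨e⟩⟩ := h
  obtain ⟨Q, k, q, hQ, h⟩ := exists_conflation_syzygy X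
  obtain ⟨Q', k', q', hQ', h'⟩ := exists_conflation_syzygy X'
  exact ((h.biprod_id P).comp_iso e).isStablyIso (h'.biprod_id P') (hQ.biprod hP)
    (hQ'.biprod hP')

theorem IsStablyIso.subsingleton_higherExt {X X' Y : C} (h : IsStablyIso X X') {n : ℕ}
    (hX : Subsingleton (higherExt n X Y)) : Subsingleton (higherExt n X' Y) := by
  induction n generalizing X X' with
  | zero => exact h.subsingleton_ext1 hX
  | succ n ih => exact ih h.syzygy hX

theorem extVanish_iff {X Y : C} : ExtVanish X Y ↔ ∀ n, Subsingleton (higherExt n X Y) :=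
  forall_congr' fun _ => (subsingleton_iff_forall_eq 0).symm

theorem ExtVanish.of_iso {X X' Y Y' : C} (h : ExtVanish X Y) (e : X ≅ X') (f : Y ≅ Y') :
    ExtVanish X' Y' := by
  rw [extVanish_iff] at h ⊢
  intro n
  have := (IsStablyIso.of_iso e).subsingleton_higherExt (h n)
  exact subsingleton_ext1_of_retract_right (Retract.ofIso f.symm)

theorem ExtVanish.biprod {T X Z : C} (hX : ExtVanish T X) (hZ : ExtVanish T Z) :
    ExtVanish T (X ⊞ Z) := by
  rw [extVanish_iff] at hX hZ ⊢
  intro n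
  have := hX n
  have := hZ n
  exact subsingleton_ext1_biprod_right

theorem coresolvedBy.of_iso {T : ObjectProperty C} {X X' : C} (h : coresolvedBy T X) (e : X ≅ X') :
    coresolvedBy T X' := by
  obtain ⟨K, T', g, f, rfl, hgf, hK, hT⟩ := h
  refine ⟨fun | 0 => X' | n + 1 => K (n + 1), T', fun | 0 => e.inv ≫ g 0 | n + 1 => g (n + 1),
    f, rfl, ?_, ?_, hT⟩
  · rintro (_ | n)
    · exact (hgf 0).iso_comp e.symm
    · exact hgf (n + 1)
  · rintro (_ | n)
    · exact fun Y hY => (hK 0 Y hY).of_iso e (Iso.refl Y)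
    · exact hK (n + 1)

end Projectives

section Functors

variable {A : Type u₁} [Category.{v₁} A] [Preadditive A] [HasZeroObject A]
  [HasBinaryBiproducts A] [ExtriangulatedCategory.{w₁} A]
  {B : Type u₂} [Category.{v₂} B] [Preadditive B] [HasZeroObject B]
  [HasBinaryBiproducts B] [ExtriangulatedCategory.{w₂} B]

/-- The functor `F` sends conflations to conflations.  Exact functors into a category satisfying
(WIC) have this property. -/
class PreservesConflations (F : A ⥤ B) : Prop where
  map_isConflation : ∀ {X Y Z : A} {x : X ⟶ Y} {y : Y ⟶ Z}, IsConflation x y →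
    IsConflation (F.map x) (F.map y)

theorem IsConflation.map (F : A ⥤ B) [PreservesConflations F] {X Y Z : A} {x : X ⟶ Y} {y : Y ⟶ Z}
    (h : IsConflation x y) : IsConflation (F.map x) (F.map y) :=
  PreservesConflations.map_isConflation h

theorem IsInflation.map (F : A ⥤ B) [PreservesConflations F] {X Y : A} {f : X ⟶ Y}
    (h : IsInflation f) : IsInflation (F.map f) :=
  let ⟨_, _, h⟩ := h
  ⟨_, _, h.map F⟩

theorem IsExactFunctor.preservesConflations [IsWIC B] {F : A ⥤ B} (hF : IsExactFunctor F) :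
    PreservesConflations F where
  map_isConflation := by
    rintro X Y Z x y ⟨δ, hδ⟩
    obtain ⟨X', g, η, hg, hη, -⟩ := hF.rightExact.exists_natural
    obtain ⟨Z', g', η', -, hη', -⟩ := hF.leftExact.exists_natural
    obtain ⟨f, hf, hgf⟩ := hη x y δ hδ
    obtain ⟨f', hf', -⟩ := hη' x y δ hδ
    have hinfl : IsInflation (g δ) :=
      IsWIC.inflation_of_comp (g δ) f (by rw [hgf]; exact ⟨_, f', _, hf'⟩)
    have : IsIso (g δ) := (hg δ).2 hinfl (hg δ).1
    rw [← hgf]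
    exact IsConflation.iso_comp ⟨_, hf⟩ (asIso (g δ))

variable {L : B ⥤ A} {R : A ⥤ B} (adj : L ⊣ R)
include adj

theorem IsProjective.map_of_adjunction [PreservesConflations R] {P : B} (hP : IsProjective P) :
    IsProjective (L.obj P) := by
  intro X Y Z x y h f
  obtain ⟨g, hg⟩ := hP _ _ (h.map R) (adj.homEquiv _ _ f)
  refine ⟨(adj.homEquiv _ _).symm g, ?_⟩
  rw [← adj.homEquiv_naturality_right_symm, hg, Equiv.symm_apply_apply]

theorem subsingleton_ext1_of_adjunction [PreservesConflations L] {Z : B} {Y : A}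
    (hZ : Subsingleton (Ext1 (L.obj Z) Y)) : Subsingleton (Ext1 Z (R.obj Y)) :=
  subsingleton_of_forall_eq 0 fun δ => by
    obtain ⟨M, x, y, hxy⟩ := ExtriangulatedCategory.exists_realizes δ
    obtain ⟨ε, hε⟩ := IsConflation.map L ⟨δ, hxy⟩
    obtain ⟨r, hr⟩ := hε.exists_desc_of_push_eq_zero (T := Y) (adj.counit.app Y)
      (Subsingleton.elim _ 0)
    refine IsETriangle.eq_zero_of_retraction hxy (adj.homEquiv _ _ r) ?_
    rw [← adj.homEquiv_naturality_left, hr, adj.homEquiv_unit, adj.right_triangle_components]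

theorem subsingleton_higherExt_of_adjunction [HasEnoughProjectives A] [HasEnoughProjectives B]
    [PreservesConflations L] [PreservesConflations R] {X : B} {Y : A} {n : ℕ}
    (h : Subsingleton (higherExt n (L.obj X) Y)) : Subsingleton (higherExt n X (R.obj Y)) := by
  induction n generalizing X with
  | zero => exact subsingleton_ext1_of_adjunction adj h
  | succ n ih =>
    obtain ⟨P, k, p, hP, hkp⟩ := exists_conflation_syzygy X
    have hL : IsStablyIso (syzygy (L.obj X)) (L.obj (syzygy X)) :=
      (hkp.map L).isStablyIso_syzygy (hP.map_of_adjunction adj)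
    exact ih (hL.subsingleton_higherExt h)

theorem ExtVanish.of_adjunction [HasEnoughProjectives A] [HasEnoughProjectives B]
    [PreservesConflations L] [PreservesConflations R] {X : B} {Y : A}
    (h : ExtVanish (L.obj X) Y) : ExtVanish X (R.obj Y) :=
  extVanish_iff.2 fun n => subsingleton_higherExt_of_adjunction adj (extVanish_iff.1 h n)

end Functors

namespace Recollement

variable {A : Type u₁} [Category.{v₁} A] [Preadditive A] [HasZeroObject A]
  [HasBinaryBiproducts A] [ExtriangulatedCategory.{w₁} A]
  {B : Type u₂} [Category.{v₂} B] [Preadditive B] [HasZeroObject B]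
  [HasBinaryBiproducts B] [ExtriangulatedCategory.{w₂} B]
  {C : Type u₃} [Category.{v₃} C] [Preadditive C] [HasZeroObject C]
  [HasBinaryBiproducts C] [ExtriangulatedCategory.{w₃} C]
  (R : Recollement A B C)

instance : R.iLowerStar.Full := R.iLowerStar_full
instance : R.iLowerStar.Faithful := R.iLowerStar_faithful
instance : R.jLowerShriek.Full := R.jLowerShriek_full
instance : R.jLowerShriek.Faithful := R.jLowerShriek_faithful
instance : R.jLowerStar.Full := R.jLowerStar_full
instance : R.jLowerStar.Faithful := R.jLowerStar_faithful
instance : R.jUpperStar.Additive := R.jUpperStar_exact.rightExact.additive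
instance : R.iUpperStar.Additive := R.iUpperStar_rightExact.additive
instance : R.iUpperShriek.Additive := R.iUpperShriek_leftExact.additive

instance [IsWIC B] : PreservesConflations R.iLowerStar :=
  R.iLowerStar_exact.preservesConflations

instance [IsWIC C] : PreservesConflations R.jUpperStar :=
  R.jUpperStar_exact.preservesConflations

theorem isZero_jUpperStar_iLowerStar (X : A) : IsZero (R.jUpperStar.obj (R.iLowerStar.obj X)) :=
  (R.essImage_eq_ker _).1 (R.iLowerStar.obj_mem_essImage X)

theorem isZero_iUpperShriek_jLowerStar (U : C) :
    IsZero (R.iUpperShriek.obj (R.jLowerStar.obj U)) := by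
  rw [IsZero.iff_id_eq_zero]
  apply (R.adjI₂.homEquiv _ _).symm.injective
  apply (R.adjJ₂.homEquiv _ _).symm.injective
  exact (R.isZero_jUpperStar_iLowerStar _).eq_of_src _ _

theorem isZero_iUpperStar_jLowerShriek (U : C) :
    IsZero (R.iUpperStar.obj (R.jLowerShriek.obj U)) := by
  rw [IsZero.iff_id_eq_zero]
  apply (R.adjI₁.homEquiv _ _).injective
  apply (R.adjJ₁.homEquiv _ _).injective
  exact (R.isZero_jUpperStar_iLowerStar _).eq_of_tgt _ _

/-- Half of `θ`-`ν`-compatibility: the adjunction morphisms `θ_X : i_* i^! X ⟶ X` are compatible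
for all `X`. -/
def IsThetaCompatible : Prop :=
  ∀ X : B, IsCompatible (R.adjI₂.counit.app X : R.iLowerStar.obj (R.iUpperShriek.obj X) ⟶ X)

section IUpperShriekExact

variable [PreservesConflations R.iUpperShriek]

theorem isConflation_adjI₂_counit_adjJ₂_unit (X : B) :
    IsConflation (R.adjI₂.counit.app X : R.iLowerStar.obj (R.iUpperShriek.obj X) ⟶ X)
      (R.adjJ₂.unit.app X : X ⟶ R.jLowerStar.obj (R.jUpperStar.obj X)) := by
  obtain ⟨A', z, K, y₁, y₂, h₁, h₂, hy, -⟩ := R.left_sequence X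
  have hK : IsZero (R.iUpperShriek.obj K) := (h₁.map R.iUpperShriek).isZero_right_of_isIso
  have hiA' : IsZero (R.iUpperShriek.obj (R.iLowerStar.obj A')) :=
    (h₂.map R.iUpperShriek).isZero_right hK (R.isZero_iUpperShriek_jLowerStar _)
  have hA' : IsZero A' := hiA'.of_iso (asIso (R.adjI₂.unit.app A'))
  have : IsIso y₂ := h₂.isIso_left (R.iLowerStar.map_isZero hA')
  rw [← hy]
  exact h₁.comp_iso (asIso y₂)

theorem isIso_adjJ₂_unit_app {X : B} (hX : IsZero (R.iUpperShriek.obj X)) :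
    IsIso (R.adjJ₂.unit.app X) :=
  (R.isConflation_adjI₂_counit_adjJ₂_unit X).isIso_right (R.iLowerStar.map_isZero hX)

theorem isIso_of_isIso_jUpperStar_map {X Y : B} (f : X ⟶ Y)
    (hX : IsZero (R.iUpperShriek.obj X)) (hY : IsZero (R.iUpperShriek.obj Y))
    [IsIso (R.jUpperStar.map f)] : IsIso f := by
  have := R.isIso_adjJ₂_unit_app hX
  have := R.isIso_adjJ₂_unit_app hY
  have hf : f ≫ R.adjJ₂.unit.app Y =
      R.adjJ₂.unit.app X ≫ R.jLowerStar.map (R.jUpperStar.map f) :=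
    R.adjJ₂.unit.naturality f
  have : IsIso (f ≫ R.adjJ₂.unit.app Y) := hf ▸ inferInstance
  exact IsIso.of_isIso_comp_right f (R.adjJ₂.unit.app Y)

instance [IsWIC C] : PreservesConflations R.jLowerStar where
  map_isConflation := by
    rintro X Y Z x y ⟨δ, hδ⟩
    obtain ⟨Z', g, η, hg, hη, -⟩ := R.jLowerStar_leftExact.exists_natural
    obtain ⟨f, hf, hfg⟩ := hη x y δ hδ
    obtain ⟨hinfl, hcomp⟩ := hg δ
    have hf : IsConflation (R.jLowerStar.map x) f := ⟨_, hf⟩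
    have hZ' : IsZero (R.iUpperShriek.obj (Z' δ)) :=
      (hf.map R.iUpperShriek).isZero_right (R.isZero_iUpperShriek_jLowerStar X)
        (R.isZero_iUpperShriek_jLowerStar Y)
    have hdefl : IsDeflation (R.jUpperStar.map (g δ)) := by
      apply IsWIC.deflation_of_comp (R.jUpperStar.map f)
      rw [← R.jUpperStar.map_comp, hfg]
      exact IsDeflation.of_iso ⟨X, x, δ, hδ⟩ (asIso (R.adjJ₂.counit.app Y)).symm
        (asIso (R.adjJ₂.counit.app Z)).symm
        (by simp [← R.adjJ₂.counit_naturality_assoc])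
    have : IsIso (R.jUpperStar.map (g δ)) :=
      R.jUpperStar_exact.leftExact.map_compatible _ hcomp (hinfl.map R.jUpperStar) hdefl
    have : IsIso (g δ) :=
      R.isIso_of_isIso_jUpperStar_map (g δ) hZ' (R.isZero_iUpperShriek_jLowerStar Z)
    rw [← hfg]
    exact hf.comp_iso (asIso (g δ))

end IUpperShriekExact

theorem isConflation_adjJ₁_counit_adjI₁_unit [PreservesConflations R.iUpperStar] (X : B) :
    IsConflation (R.adjJ₁.counit.app X : R.jLowerShriek.obj (R.jUpperStar.obj X) ⟶ X)
      (R.adjI₁.unit.app X : X ⟶ R.iLowerStar.obj (R.iUpperStar.obj X)) := by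
  obtain ⟨A', x, L, z₁, z₂, h₁, h₂, hz, -⟩ := R.right_sequence X
  have hL : IsZero (R.iUpperStar.obj L) := (h₂.map R.iUpperStar).isZero_left_of_isIso
  have hiA' : IsZero (R.iUpperStar.obj (R.iLowerStar.obj A')) :=
    (h₁.map R.iUpperStar).isZero_left (R.isZero_iUpperStar_jLowerShriek _) hL
  have hA' : IsZero A' := hiA'.of_iso (asIso (R.adjI₁.counit.app A')).symm
  have : IsIso z₁ := h₁.isIso_right (R.iLowerStar.map_isZero hA')
  rw [← hz]
  exact h₂.iso_comp (asIso z₁)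

section Split

variable [PreservesConflations R.iUpperShriek] [PreservesConflations R.iUpperStar] [IsWIC C]
  (hθ : R.IsThetaCompatible)
include hθ

theorem isCompatible_zero_of_isZero_iUpperStar {X : B} (hX : IsZero (R.iUpperStar.obj X)) :
    IsCompatible (0 : X ⟶ 0) := by
  -- The conflation `X ⟶ 0 ⟶ T` makes `T` a shift of `X`, and so `j_* j^* T` a shift of
  -- `j_* j^* X`; rotating `i_* i^! T ⟶ T ⟶ j_* j^* T` backwards then makes `θ_T` a deflation.
  rintro ⟨T, t, hT⟩ -
  have hiT : IsZero (R.iUpperStar.obj T) :=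
    (hT.map R.iUpperStar).isZero_right hX (R.iUpperStar.map_isZero (isZero_zero B))
  have hθT : IsConflation (R.adjI₂.counit.app T : _ ⟶ T) (R.adjJ₂.unit.app T) :=
    R.isConflation_adjI₂_counit_adjJ₂_unit T
  have hdefl : IsDeflation (R.adjI₂.counit.app T : _ ⟶ T) :=
    hθT.isDeflation_of_isZero ((hT.map R.jUpperStar).map R.jLowerStar)
      (R.jLowerStar.map_isZero (R.jUpperStar.map_isZero (isZero_zero B)))
  have : IsIso (R.adjI₂.counit.app T) := hθ T ⟨_, _, hθT⟩ hdefl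
  have hi : IsZero (R.iUpperShriek.obj T) :=
    hiT.of_iso ((asIso (R.adjI₁.counit.app _)).symm ≪≫
      R.iUpperStar.mapIso (asIso (R.adjI₂.counit.app T)))
  have hT₀ : IsZero T :=
    (R.iLowerStar.map_isZero hi).of_iso (asIso (R.adjI₂.counit.app T)).symm
  exact hT.isIso_left hT₀

theorem isZero_iUpperShriek_jLowerShriek (V : C) :
    IsZero (R.iUpperShriek.obj (R.jLowerShriek.obj V)) := by
  have hcomp : IsCompatible (R.iUpperShriek.map (0 : R.jLowerShriek.obj V ⟶ 0)) :=
    R.iUpperShriek_leftExact.map_compatible _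
      (R.isCompatible_zero_of_isZero_iUpperStar hθ (R.isZero_iUpperStar_jLowerShriek V))
  have hzero : IsZero (R.iUpperShriek.obj (0 : B)) := R.iUpperShriek.map_isZero (isZero_zero B)
  have hinfl : IsInflation (R.adjJ₁.counit.app (R.jLowerStar.obj V)) :=
    ⟨_, _, R.isConflation_adjJ₁_counit_adjI₁_unit (R.jLowerStar.obj V)⟩
  have hinfl' : IsInflation (R.iUpperShriek.map (0 : R.jLowerShriek.obj V ⟶ 0)) :=
    (hinfl.map R.iUpperShriek).of_iso
      (R.iUpperShriek.mapIso (R.jLowerShriek.mapIso (asIso (R.adjJ₂.counit.app V))))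
      ((R.isZero_iUpperShriek_jLowerStar V).iso hzero) (hzero.eq_of_tgt _ _)
  have := hcomp hinfl' (isDeflation_of_isZero hzero _)
  exact hzero.of_iso (asIso (R.iUpperShriek.map (0 : R.jLowerShriek.obj V ⟶ 0)))

theorem isZero_iUpperStar_jLowerStar (V : C) :
    IsZero (R.iUpperStar.obj (R.jLowerStar.obj V)) := by
  have h : IsZero (R.iUpperShriek.obj
      (R.iLowerStar.obj (R.iUpperStar.obj (R.jLowerStar.obj V)))) :=
    ((R.isConflation_adjJ₁_counit_adjI₁_unit (R.jLowerStar.obj V)).map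
      R.iUpperShriek).isZero_right (R.isZero_iUpperShriek_jLowerShriek hθ _)
        (R.isZero_iUpperShriek_jLowerStar V)
  exact h.of_iso (asIso (R.adjI₂.unit.app _))

theorem nonempty_iso_iUpperStar_iUpperShriek (X : B) :
    Nonempty (R.iUpperStar.obj X ≅ R.iUpperShriek.obj X) := by
  have : IsIso (R.iUpperStar.map (R.adjI₂.counit.app X)) :=
    ((R.isConflation_adjI₂_counit_adjJ₂_unit X).map R.iUpperStar).isIso_left
      (R.isZero_iUpperStar_jLowerStar hθ _)
  exact ⟨(asIso (R.iUpperStar.map (R.adjI₂.counit.app X))).symm ≪≫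
    asIso (R.adjI₁.counit.app (R.iUpperShriek.obj X))⟩

theorem exists_section_adjJ₂_unit (X : B) :
    ∃ s : R.jLowerStar.obj (R.jUpperStar.obj X) ⟶ X, s ≫ R.adjJ₂.unit.app X = 𝟙 _ := by
  have : IsIso (R.adjJ₂.unit.app (R.jLowerShriek.obj (R.jUpperStar.obj X))) :=
    R.isIso_adjJ₂_unit_app (R.isZero_iUpperShriek_jLowerShriek hθ _)
  have : IsIso (R.adjJ₁.counit.app X ≫ R.adjJ₂.unit.app X) := by
    have hnat : R.adjJ₂.unit.app (R.jLowerShriek.obj (R.jUpperStar.obj X)) ≫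
        R.jLowerStar.map (R.jUpperStar.map (R.adjJ₁.counit.app X)) =
          R.adjJ₁.counit.app X ≫ R.adjJ₂.unit.app X :=
      R.adjJ₂.unit_naturality (R.adjJ₁.counit.app X)
    exact hnat ▸ inferInstance
  exact ⟨inv (R.adjJ₁.counit.app X ≫ R.adjJ₂.unit.app X) ≫ R.adjJ₁.counit.app X, by simp⟩

theorem nonempty_iso_biprod (X : B) :
    Nonempty (X ≅ R.iLowerStar.obj (R.iUpperShriek.obj X) ⊞
      R.jLowerStar.obj (R.jUpperStar.obj X)) := by
  obtain ⟨s, hs⟩ := R.exists_section_adjJ₂_unit hθ X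
  obtain ⟨δ, hδ⟩ := R.isConflation_adjI₂_counit_adjJ₂_unit X
  exact hδ.nonempty_iso_biprod (hδ.eq_zero_of_section s hs)

theorem extVanish_of_extVanish [IsWIC B] [HasEnoughProjectives A] [HasEnoughProjectives B]
    [HasEnoughProjectives C] {X Y : B}
    (hi : ExtVanish (R.iUpperShriek.obj X) (R.iUpperShriek.obj Y))
    (hj : ExtVanish (R.jUpperStar.obj X) (R.jUpperStar.obj Y)) : ExtVanish X Y := by
  obtain ⟨eX⟩ := R.nonempty_iso_iUpperStar_iUpperShriek hθ X
  obtain ⟨eY⟩ := R.nonempty_iso_biprod hθ Y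
  have hi' : ExtVanish X (R.iLowerStar.obj (R.iUpperShriek.obj Y)) :=
    (hi.of_iso eX.symm (Iso.refl _)).of_adjunction R.adjI₁
  have hj' : ExtVanish X (R.jLowerStar.obj (R.jUpperStar.obj Y)) := hj.of_adjunction R.adjJ₂
  exact (hi'.biprod hj').of_iso (Iso.refl X) eY.symm

end Split

/-- `i^! (i_* X ⊕ j_* U) ≅ X`, since `i^!` vanishes on the image of `j_*`. -/
noncomputable def iUpperShriekBiprodIso (X : A) (U : C) :
    R.iUpperShriek.obj (R.iLowerStar.obj X ⊞ R.jLowerStar.obj U) ≅ X :=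
  have := preservesBinaryBiproducts_of_preservesBiproducts R.iUpperShriek
  R.iUpperShriek.mapBiprod _ _ ≪≫
    (isoBiprodZero (R.isZero_iUpperShriek_jLowerStar U)).symm ≪≫
      (asIso (R.adjI₂.unit.app X)).symm

/-- `j^* (i_* X ⊕ j_* U) ≅ U`, since `j^*` vanishes on the image of `i_*`. -/
noncomputable def jUpperStarBiprodIso (X : A) (U : C) :
    R.jUpperStar.obj (R.iLowerStar.obj X ⊞ R.jLowerStar.obj U) ≅ U :=
  have := preservesBinaryBiproducts_of_preservesBiproducts R.jUpperStar
  R.jUpperStar.mapBiprod _ _ ≪≫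
    (isoZeroBiprod (R.isZero_jUpperStar_iLowerStar X)).symm ≪≫
      asIso (R.adjJ₂.counit.app U)

section Glue

variable {X' : ObjectProperty A} {X'' : ObjectProperty C}

theorem glue_biprod [X'.IsClosedUnderIsomorphisms] [X''.IsClosedUnderIsomorphisms]
    {M : A} {N : C} (hM : X' M) (hN : X'' N) :
    R.glue X' X'' (R.iLowerStar.obj M ⊞ R.jLowerStar.obj N) :=
  ⟨X'.prop_of_iso (R.iUpperShriekBiprodIso M N).symm hM,
    X''.prop_of_iso (R.jUpperStarBiprodIso M N).symm hN⟩

variable [PreservesConflations R.iUpperShriek] [PreservesConflations R.iUpperStar]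
  [IsWIC B] [IsWIC C] [HasEnoughProjectives A] [HasEnoughProjectives B] [HasEnoughProjectives C]
  (hθ : R.IsThetaCompatible)
include hθ

theorem leftPerp_glue_biprod {M : A} {N : C} (hM : leftPerp X' M) (hN : leftPerp X'' N) :
    leftPerp (R.glue X' X'') (R.iLowerStar.obj M ⊞ R.jLowerStar.obj N) :=
  fun _ hY => R.extVanish_of_extVanish hθ
    ((hM _ hY.1).of_iso (R.iUpperShriekBiprodIso M N).symm (Iso.refl _))
    ((hN _ hY.2).of_iso (R.jUpperStarBiprodIso M N).symm (Iso.refl _))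

theorem coresolvedBy_glue_biprod [X'.IsClosedUnderIsomorphisms] [X''.IsClosedUnderIsomorphisms]
    {M : A} {N : C} (hM : coresolvedBy X' M) (hN : coresolvedBy X'' N) :
    coresolvedBy (R.glue X' X'') (R.iLowerStar.obj M ⊞ R.jLowerStar.obj N) := by
  obtain ⟨K', T', g', f', rfl, hgf', hK', hT'⟩ := hM
  obtain ⟨K'', T'', g'', f'', rfl, hgf'', hK'', hT''⟩ := hN
  exact ⟨fun n => R.iLowerStar.obj (K' n) ⊞ R.jLowerStar.obj (K'' n),
    fun n => R.iLowerStar.obj (T' n) ⊞ R.jLowerStar.obj (T'' n), _, _, rfl,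
    fun n => ((hgf' n).map R.iLowerStar).biprod ((hgf'' n).map R.jLowerStar),
    fun n => R.leftPerp_glue_biprod hθ (hK' n) (hK'' n), fun n => R.glue_biprod (hT' n) (hT'' n)⟩

theorem coresolvedBy_glue_of_isProjective [X'.IsClosedUnderIsomorphisms]
    [X''.IsClosedUnderIsomorphisms] (hX' : ∀ P : A, IsProjective P → coresolvedBy X' P)
    (hX'' : ∀ P : C, IsProjective P → coresolvedBy X'' P) {P : B} (hP : IsProjective P) :
    coresolvedBy (R.glue X' X'') P := by
  obtain ⟨e⟩ := R.nonempty_iso_biprod hθ P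
  obtain ⟨e'⟩ := R.nonempty_iso_iUpperStar_iUpperShriek hθ P
  have hPi : IsProjective (R.iUpperShriek.obj P) :=
    IsProjective.of_iso (hP.map_of_adjunction R.adjI₁) e'
  have hPj : IsProjective (R.jUpperStar.obj P) := hP.map_of_adjunction R.adjJ₂
  exact (R.coresolvedBy_glue_biprod hθ (hX' _ hPi) (hX'' _ hPj)).of_iso e.symm

end Glue

end Recollement

namespace IsWakamatsuTilting

variable {A : Type u₁} [Category.{v₁} A] [Preadditive A] [HasZeroObject A]
  [HasBinaryBiproducts A] [ExtriangulatedCategory.{w₁} A] [HasEnoughProjectives A]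
  {T : ObjectProperty A} (hT : IsWakamatsuTilting T)
include hT

theorem isClosedUnderIsomorphisms : T.IsClosedUnderIsomorphisms := ⟨hT.closed_iso⟩

theorem map_summand {B : Type u₂} [Category.{v₂} B] [Preadditive B] [HasBinaryBiproducts B]
    (F : B ⥤ A) [F.Additive] {X Y : B} (h : T (F.obj (X ⊞ Y))) : T (F.obj X) :=
  have := preservesBinaryBiproducts_of_preservesBiproducts F
  hT.closed_summand _ (F.obj Y) (hT.closed_iso (F.mapBiprod X Y) h)

end IsWakamatsuTilting

end Extri

theorem theorem4p6_general
    {A : Type u₁} [Category.{v₁} A] [Preadditive A] [HasZeroObject A] [HasBinaryBiproducts A]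
    [Extri.ExtriangulatedCategory.{w₁} A] [Extri.HasEnoughProjectives A]
    {B : Type u₂} [Category.{v₂} B] [Preadditive B] [HasZeroObject B] [HasBinaryBiproducts B]
    [Extri.ExtriangulatedCategory.{w₂} B] [Extri.HasEnoughProjectives B] [Extri.IsWIC B]
    {C : Type u₃} [Category.{v₃} C] [Preadditive C] [HasZeroObject C] [HasBinaryBiproducts C]
    [Extri.ExtriangulatedCategory.{w₃} C] [Extri.HasEnoughProjectives C] [Extri.IsWIC C]
    (R : Extri.Recollement A B C) (hθ : R.IsThetaCompatible)
    [Extri.PreservesConflations R.iUpperShriek] [Extri.PreservesConflations R.iUpperStar]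
    {X' : ObjectProperty A} {X'' : ObjectProperty C}
    (hX' : Extri.IsWakamatsuTilting X') (hX'' : Extri.IsWakamatsuTilting X'') :
    Extri.IsWakamatsuTilting (R.glue X' X'') where
  closed_iso e h := ⟨hX'.closed_iso (R.iUpperShriek.mapIso e) h.1,
    hX''.closed_iso (R.jUpperStar.mapIso e) h.2⟩
  closed_summand _ _ h := ⟨hX'.map_summand R.iUpperShriek h.1, hX''.map_summand R.jUpperStar h.2⟩
  self_orthogonal _ _ hX hY := R.extVanish_of_extVanish hθ
    (hX'.self_orthogonal _ _ hX.1 hY.1) (hX''.self_orthogonal _ _ hX.2 hY.2)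
  projective_coresolved _ hP :=
    have := hX'.isClosedUnderIsomorphisms
    have := hX''.isClosedUnderIsomorphisms
    R.coresolvedBy_glue_of_isProjective hθ hX'.projective_coresolved
      hX''.projective_coresolved hP

theorem theorem4p6
    {A : Type u₁} [Category.{v₁} A] [Preadditive A] [HasZeroObject A] [HasBinaryBiproducts A]
    [Extri.ExtriangulatedCategory.{w₁} A] [Extri.HasEnoughProjectives A]
    [Extri.HasEnoughInjectives A] [Extri.IsWIC A]
    {B : Type u₂} [Category.{v₂} B] [Preadditive B] [HasZeroObject B] [HasBinaryBiproducts B]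
    [Extri.ExtriangulatedCategory.{w₂} B] [Extri.HasEnoughProjectives B]
    [Extri.HasEnoughInjectives B] [Extri.IsWIC B]
    {C : Type u₃} [Category.{v₃} C] [Preadditive C] [HasZeroObject C] [HasBinaryBiproducts C]
    [Extri.ExtriangulatedCategory.{w₃} C] [Extri.HasEnoughProjectives C]
    [Extri.HasEnoughInjectives C] [Extri.IsWIC C]
    (R : Extri.Recollement A B C) (hR : R.IsThetaNuCompatible)
    (hiShriek : Extri.IsExactFunctor R.iUpperShriek)
    (hiStar : Extri.IsExactFunctor R.iUpperStar)
    (X' : ObjectProperty A) (X'' : ObjectProperty C)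
    (hX' : Extri.IsWakamatsuTilting X') (hX'' : Extri.IsWakamatsuTilting X'') :
    Extri.IsWakamatsuTilting (R.glue X' X'') :=
  have := hiShriek.preservesConflations
  have := hiStar.preservesConflations
  theorem4p6_general R (fun X => (hR X).1) hX' hX''
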